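/- Let $d\ge 1$ and $p\in[0,1]$, and let $\mathcal N_p(\rho)=(1-p)\rho+p\,\mathrm{Tr}(\rho)\,|e\rangle\langle e|$ be the quantum erasure channel on a $d$-dimensional input space, where $|e\rangle$ is a unit vector orthogonal to the input space. A classical code for $n\ge 1$ uses of $\mathcal N_p$ with $M$ messages consists of density operators $\rho_1,\dots,\rho_M$ on $(\mathbb C^d)^{\otimes n}$ and a POVM $\Lambda_1,\dots,\Lambda_M$ on the $n$ output systems; its rate is $\frac1n\log_2 M$ and its success probability is $p_{\mathrm{succ}}=\frac1M\sum_m \mathrm{Tr}\{\Lambda_m\,\mathcal N_p^{\otimes n}(\rho_m)\}$. A number $R$ is achievable if for every $\varepsilon>0$ and all sufficiently large $n$ there is a code for $n$ uses with rate at least $R$ and $p_{\mathrm{succ}}\ge 1-\varepsilon$; the classical capacity is the supremum of the achievable rates. Then: (1) For every $\alpha\in(1,2]$, every $n\ge1$ and every classical code for $n$ uses of $\mathcal N_p$, of rate $R$, $$p_{\mathrm{succ}}\le 2^{-n\left(\frac{\alpha-1}{\alpha}\right)\left(R-\frac{1}{\alpha-1}\log_2\left((1-p)d^{\alpha-1}+p\right)\right)}.$$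 (2) $\displaystyle\lim_{\alpha\to1}\frac{1}{\alpha-1}\log_2\left((1-p)d^{\alpha-1}+p\right)=(1-p)\log_2 d$, and this number is the classical capacity of $\mathcal N_p$. (3) (Strong converse.) If $R>(1-p)\log_2 d$, then there is $\alpha\in(1,2]$ with $\frac{\alpha-1}{\alpha}\left(R-\frac{1}{\alpha-1}\log_2\left((1-p)d^{\alpha-1}+p\right)\right)>0$, and for every sequence of classical codes, the $n$-th one for $n$ uses of $\mathcal N_p$, whose rates are at least $R$ for all large $n$, the success probability tends to $0$ as $n\to\infty$. -/

import Mathlib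

open Filter Topology
open scoped ComplexOrder

noncomputable section

namespace QuantumErasure

/-- `X` is a density operator: positive semidefinite with unit trace. -/
def IsDensity {a : Type*} [Fintype a] (X : Matrix a a ℂ) : Prop :=
  X.PosSemidef ∧ X.trace = 1

/-- The tensor product of the operators `X 0, …, X (n-1)`, in the product basis. -/
def tensorProd {a : Type*} {n : ℕ} (X : Fin n → Matrix a a ℂ) :
    Matrix (Fin n → a) (Fin n → a) ℂ :=
  Matrix.of fun x x' => ∏ k, X k (x k) (x' k)

/-- The `n`-fold tensor power of a linear map `N` on operators, acting on operators on the
`n`-fold tensor power space. In coordinates: the matrix unit `|x⟩⟨x'|` is sent to the tensor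
product of the `N (|x k⟩⟨x' k|)`, extended linearly. -/
def tensorPower {a b : Type*} [Fintype a] [DecidableEq a]
    (N : Matrix a a ℂ →ₗ[ℂ] Matrix b b ℂ) (n : ℕ) :
    Matrix (Fin n → a) (Fin n → a) ℂ →ₗ[ℂ] Matrix (Fin n → b) (Fin n → b) ℂ where
  toFun X := ∑ x, ∑ x', X x x' • tensorProd fun k => N (Matrix.single (x k) (x' k) 1)
  map_add' X Y := by
    simp only [Matrix.add_apply, add_smul, Finset.sum_add_distrib]
  map_smul' c X := by
    simp only [Matrix.smul_apply, smul_eq_mul, mul_smul, Finset.smul_sum, RingHom.id_apply]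

/-- The tensor power acts factorwise on tensor products. -/
theorem tensorPower_tensorProd {a b : Type*} [Fintype a] [DecidableEq a]
    (N : Matrix a a ℂ →ₗ[ℂ] Matrix b b ℂ) (n : ℕ) (X : Fin n → Matrix a a ℂ) :
    tensorPower N n (tensorProd X) = tensorProd fun k => N (X k) := by
  have hN : ∀ (Y : Matrix a a ℂ) (y y' : b),
      N Y y y' = ∑ q : a × a, Y q.1 q.2 * N (Matrix.single q.1 q.2 1) y y' := by
    intro Y y y'
    conv_lhs => rw [Matrix.matrix_eq_sum_single Y]
    rw [Fintype.sum_prod_type]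
    simp only [map_sum, Matrix.sum_apply]
    refine Finset.sum_congr rfl fun i _ => Finset.sum_congr rfl fun j _ => ?_
    have h : Matrix.single i j (Y i j) = Y i j • Matrix.single i j (1 : ℂ) := by
      simp [Matrix.smul_single]
    rw [h, map_smul, Matrix.smul_apply, smul_eq_mul]
  ext y y'
  simp only [tensorPower, tensorProd, LinearMap.coe_mk, AddHom.coe_mk, Matrix.sum_apply,
    Matrix.smul_apply, Matrix.of_apply, smul_eq_mul, hN (X _), ← Finset.prod_mul_distrib]
  rw [Fintype.prod_sum, ← Fintype.sum_prod_type']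
  exact Fintype.sum_equiv (Equiv.arrowProdEquivProdArrow (Fin n) (fun _ => a) (fun _ => a)).symm
    _ _ fun _ => rfl

/-- The quantum erasure channel with erasure probability `p` on a `d`-dimensional input:
`X ↦ (1 - p) X + p Tr(X) |e⟩⟨e|`. The output space is the direct sum of the input space
and a line spanned by the erasure flag `|e⟩`, which is the basis vector indexed by `Unit`. -/
def erasureChannel (d : ℕ) (p : ℝ) :
    Matrix (Fin d) (Fin d) ℂ →ₗ[ℂ] Matrix (Fin d ⊕ Unit) (Fin d ⊕ Unit) ℂ where
  toFun X := Matrix.fromBlocks ((1 - (p : ℂ)) • X) 0 0 (((p : ℂ) * X.trace) • 1)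
  map_add' X Y := by
    simp [Matrix.fromBlocks_add, mul_add, add_smul]
  map_smul' c X := by
    simp [Matrix.fromBlocks_smul, smul_smul, mul_left_comm, mul_comm]

/-- A code for sending one of `M` classical messages over `n` uses of a channel whose input and
output spaces have orthonormal bases `a` and `b`: message `m` is encoded into the (arbitrary,
possibly entangled) density operator `state m`, and the decoder is an arbitrary joint measurement
of the `n` outputs, given by the POVM `meas`. -/
structure ClassicalCode (a b : Type*) [Fintype a] [Fintype b] [DecidableEq b] (n M : ℕ) where
  state : Fin M → Matrix (Fin n → a) (Fin n → a) ℂ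
  state_isDensity : ∀ m, IsDensity (state m)
  meas : Fin M → Matrix (Fin n → b) (Fin n → b) ℂ
  meas_posSemidef : ∀ m, (meas m).PosSemidef
  meas_sum : ∑ m, meas m = 1

/-- The probability that the message is decoded correctly when the code is used on `n` uses of the
channel `N` and the message is uniformly distributed. -/
def ClassicalCode.successProb {a b : Type*} [Fintype a] [DecidableEq a] [Fintype b]
    [DecidableEq b] {n M : ℕ} (C : ClassicalCode a b n M)
    (N : Matrix a a ℂ →ₗ[ℂ] Matrix b b ℂ) : ℝ :=
  (1 / (M : ℝ)) * ∑ m, ((C.meas m * tensorPower N n (C.state m)).trace).re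

/-- The rate, in bits per channel use, of a code with `M` messages and `n` channel uses. -/
def rate (n M : ℕ) : ℝ := Real.logb 2 M / n

/-- `R` is an achievable rate of classical communication over `N`: for every `ε > 0` and all large
enough `n` there is a code of rate at least `R` with success probability at least `1 - ε`. -/
def IsAchievable {a b : Type*} [Fintype a] [DecidableEq a] [Fintype b] [DecidableEq b]
    (N : Matrix a a ℂ →ₗ[ℂ] Matrix b b ℂ) (R : ℝ) : Prop :=
  ∀ ε : ℝ, 0 < ε → ∀ᶠ n : ℕ in atTop, ∃ (M : ℕ) (C : ClassicalCode a b n M),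
    R ≤ rate n M ∧ 1 - ε ≤ C.successProb N

/-- `Q` is the classical capacity of `N`: the supremum of the achievable rates. -/
def IsClassicalCapacity {a b : Type*} [Fintype a] [DecidableEq a] [Fintype b] [DecidableEq b]
    (N : Matrix a a ℂ →ₗ[ℂ] Matrix b b ℂ) (Q : ℝ) : Prop :=
  IsLUB {R : ℝ | IsAchievable N R} Q

/-- The single-letter quantity `(1 / (α - 1)) log₂ ((1 - p) d ^ (α - 1) + p)`. -/
def renyiBound (d : ℕ) (p α : ℝ) : ℝ :=
  1 / (α - 1) * Real.logb 2 ((1 - p) * (d : ℝ) ^ (α - 1) + p)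

end QuantumErasure

end

/-! The channel erases each position independently, and the flag makes the erasure pattern `s`
visible in the output. So the output is a sum of blocks supported on orthogonal sectors, one per
pattern, with weight `∏ k, branchWeight p (s k)`; the sector has dimension `D = d ^ (number of
survivors)`.

Converse: within a sector, `M` messages are decoded with probability at most `min 1 (D / M)`, even
for entangled inputs (`ClassicalCode.successProb_erasure_le`). Bounding this by `(D / M) ^ θ` with
`θ = (α - 1) / α` and applying Jensen reduces the average over patterns to `E[D ^ (α - 1)]`, an
`n`-th power by independence. The exponent is positive for some `α > 1` because `renyiBound` is a
difference quotient at `α = 1` with limit `(1 - p) log₂ d`.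

Achievability: on basis states the channel is the classical erasure channel. Random coding with the
same interpolation gives an error exponent governed by `renyiBound` at `α < 1`, so the left-hand
limit yields every rate below capacity. -/

noncomputable section

namespace QuantumErasure

/-! ### Trace inequalities for positive semidefinite matrices. -/

section Trace

variable {ι : Type*} [Fintype ι] [DecidableEq ι]

open scoped MatrixOrder Matrix.Norms.L2Operator in
theorem trace_mul_re_nonneg {A B : Matrix ι ι ℂ} (hA : A.PosSemidef) (hB : B.PosSemidef) :
    0 ≤ (A * B).trace.re := by
  obtain ⟨K, rfl⟩ : ∃ K : Matrix ι ι ℂ, A = K.conjTranspose * K :=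
    CStarAlgebra.nonneg_iff_eq_star_mul_self.mp hA.nonneg
  have h := (hB.mul_mul_conjTranspose_same K).trace_nonneg
  rw [Matrix.trace_mul_comm, ← mul_assoc] at h
  exact (Complex.le_def.1 h).1

/-- In an eigenbasis of `A`, each eigenvalue is at most the sum of all of them, since none is
negative. -/
theorem trace_smul_one_sub_posSemidef {A : Matrix ι ι ℂ} (hA : A.PosSemidef) :
    (A.trace • (1 : Matrix ι ι ℂ) - A).PosSemidef := by
  have htr := hA.1.trace_eq_sum_eigenvalues
  have key : A.trace • (1 : Matrix ι ι ℂ) - A =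
      (hA.1.eigenvectorUnitary : Matrix ι ι ℂ) *
        Matrix.diagonal (fun i => A.trace - (hA.1.eigenvalues i : ℂ)) *
        (hA.1.eigenvectorUnitary : Matrix ι ι ℂ).conjTranspose := by
    have h := hA.1.spectral_theorem
    rw [Unitary.conjStarAlgAut_apply, Matrix.star_eq_conjTranspose] at h
    have h2 := Unitary.mul_star_self_of_mem hA.1.eigenvectorUnitary.2
    rw [Matrix.star_eq_conjTranspose] at h2
    have h1 : Matrix.diagonal (fun i => A.trace - (hA.1.eigenvalues i : ℂ)) =
        A.trace • (1 : Matrix ι ι ℂ) - Matrix.diagonal (RCLike.ofReal ∘ hA.1.eigenvalues) := by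
      ext i j
      by_cases hij : i = j <;> simp [hij]
    rw [h1, mul_sub, sub_mul, ← h, mul_smul_comm, mul_one, smul_mul_assoc, h2]
  rw [key]
  refine Matrix.PosSemidef.mul_mul_conjTranspose_same ?_ _
  refine Matrix.PosSemidef.diagonal fun i => ?_
  rw [htr, Pi.zero_apply, sub_nonneg]
  have := Finset.single_le_sum (f := hA.1.eigenvalues) (fun i _ => hA.eigenvalues_nonneg i)
    (Finset.mem_univ i)
  simpa using Complex.real_le_real.2 this

theorem trace_mul_re_le {A B : Matrix ι ι ℂ} {w : ℝ} (hA : A.PosSemidef) (hB : B.PosSemidef)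
    (hw : B.trace = w) : (A * B).trace.re ≤ w * A.trace.re := by
  have h := trace_mul_re_nonneg hA (trace_smul_one_sub_posSemidef hB)
  rw [mul_sub, Matrix.trace_sub, Complex.sub_re, hw, mul_smul_comm, mul_one, Matrix.trace_smul,
    smul_eq_mul, Complex.re_ofReal_mul] at h
  linarith

end Trace

/-! ### Tensor products of possibly different linear maps. -/

section TensorMap

variable {a b I : Type*} [Fintype a] [DecidableEq a] {n : ℕ}

/-- The tensor product of the linear maps `N 0, …, N (n-1)`, in coordinates. -/
def tensorMap (N : Fin n → Matrix a a ℂ →ₗ[ℂ] Matrix b b ℂ) (X : Matrix (Fin n → a) (Fin n → a) ℂ) :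
    Matrix (Fin n → b) (Fin n → b) ℂ :=
  ∑ x, ∑ x', X x x' • tensorProd fun k => N k (Matrix.single (x k) (x' k) 1)

theorem tensorMap_apply (N : Fin n → Matrix a a ℂ →ₗ[ℂ] Matrix b b ℂ)
    (X : Matrix (Fin n → a) (Fin n → a) ℂ) (y y' : Fin n → b) :
    tensorMap N X y y' =
      ∑ x, ∑ x', X x x' * ∏ k, N k (Matrix.single (x k) (x' k) 1) (y k) (y' k) := by
  simp [tensorMap, tensorProd, Matrix.sum_apply]

/-- Multilinear expansion. For the erasure channel `I` is `Bool` and `s` is the erasure pattern. -/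
theorem tensorPower_eq_sum_tensorMap [Fintype I] {N : Matrix a a ℂ →ₗ[ℂ] Matrix b b ℂ}
    {E : I → Matrix a a ℂ →ₗ[ℂ] Matrix b b ℂ} (h : ∀ X, N X = ∑ i, E i X)
    (X : Matrix (Fin n → a) (Fin n → a) ℂ) :
    tensorPower N n X = ∑ s : Fin n → I, tensorMap (fun k => E (s k)) X := by
  classical
  ext y y'
  have h1 : tensorPower N n X = tensorMap (fun _ => N) X := rfl
  rw [h1, tensorMap_apply, Matrix.sum_apply]
  simp only [tensorMap_apply, h, Matrix.sum_apply, Fintype.prod_sum, Finset.mul_sum]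
  exact (Finset.sum_congr rfl fun x _ => Finset.sum_comm).trans Finset.sum_comm

theorem trace_tensorMap [Fintype b] {N : Fin n → Matrix a a ℂ →ₗ[ℂ] Matrix b b ℂ} {w : Fin n → ℂ}
    (h : ∀ k X, (N k X).trace = w k * X.trace) (X : Matrix (Fin n → a) (Fin n → a) ℂ) :
    (tensorMap N X).trace = (∏ k, w k) * X.trace := by
  have h1 : ∀ x x' : Fin n → a, (tensorProd fun k => N k (Matrix.single (x k) (x' k) 1)).trace =
      if x = x' then ∏ k, w k else 0 := by
    intro x x'
    have : (tensorProd fun k => N k (Matrix.single (x k) (x' k) 1)).trace =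
        ∏ k, (N k (Matrix.single (x k) (x' k) 1)).trace := by
      simp only [Matrix.trace, Matrix.diag, tensorProd, Matrix.of_apply, Fintype.prod_sum]
    rw [this]
    simp only [h]
    split_ifs with hx
    · subst hx
      simp
    · obtain ⟨k, hk⟩ := Function.ne_iff.1 hx
      refine Finset.prod_eq_zero (Finset.mem_univ k) ?_
      rw [Matrix.trace_single_eq_of_ne _ _ _ hk, mul_zero]
  simp only [tensorMap, Matrix.trace_sum, Matrix.trace_smul, h1]
  simp [Matrix.trace, Finset.mul_sum, mul_comm]

/-- Inputs may be entangled, so positivity of each factor would not suffice. Kraus forms do: the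
tensor products `T κ` of Kraus operators form a Kraus family for the product map. -/
theorem tensorMap_posSemidef [Fintype b] [Fintype I] {N : Fin n → Matrix a a ℂ →ₗ[ℂ] Matrix b b ℂ}
    {K : Fin n → I → Matrix b a ℂ} (h : ∀ k X, N k X = ∑ i, K k i * X * (K k i).conjTranspose)
    {X : Matrix (Fin n → a) (Fin n → a) ℂ} (hX : X.PosSemidef) : (tensorMap N X).PosSemidef := by
  classical
  let T : (Fin n → I) → Matrix (Fin n → b) (Fin n → a) ℂ := fun κ =>
    Matrix.of fun y x => ∏ k, K k (κ k) (y k) (x k)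
  have key : tensorMap N X = ∑ κ, T κ * X * (T κ).conjTranspose := by
    have h1 : ∀ k i j y y', N k (Matrix.single i j 1) y y' =
        ∑ l, K k l y i * star (K k l y' j) := by
      intro k i j y y'
      rw [h, Matrix.sum_apply]
      refine Finset.sum_congr rfl fun l _ => ?_
      rw [Matrix.mul_apply, Finset.sum_eq_single j] <;>
        simp +contextual [Matrix.mul_apply, Matrix.single_apply, Matrix.conjTranspose_apply]
      intro b hb
      exact Or.inl (Finset.sum_eq_zero fun x _ => by simp [Ne.symm hb])
    ext y y'
    rw [tensorMap_apply, Matrix.sum_apply]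
    simp only [h1, Fintype.prod_sum, Finset.mul_sum, Finset.prod_mul_distrib]
    refine (Finset.sum_congr rfl fun x _ => Finset.sum_comm).trans
      (Finset.sum_comm.trans (Finset.sum_congr rfl fun κ _ => ?_))
    rw [Finset.sum_comm]
    simp only [T, Matrix.mul_apply, Matrix.of_apply, Matrix.conjTranspose_apply, Finset.sum_mul,
      star_prod]
    exact Finset.sum_congr rfl fun x' _ => Finset.sum_congr rfl fun x _ => by ring
  rw [key]
  exact Matrix.posSemidef_sum _ fun κ _ => hX.mul_mul_conjTranspose_same _

end TensorMap

/-! ### Decomposition of the erasure channel by erasure pattern. -/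

/-- The two branches of the erasure channel: `false` transmits the input with weight `1 - p`,
`true` replaces it by the erasure flag with weight `p`. -/
def erasureBranch (d : ℕ) (p : ℝ) :
    Bool → Matrix (Fin d) (Fin d) ℂ →ₗ[ℂ] Matrix (Fin d ⊕ Unit) (Fin d ⊕ Unit) ℂ
  | false =>
    { toFun := fun X => Matrix.fromBlocks ((1 - (p : ℂ)) • X) 0 0 0
      map_add' := fun X Y => by simp [Matrix.fromBlocks_add]
      map_smul' := fun c X => by simp [Matrix.fromBlocks_smul, smul_smul, mul_comm] }
  | true =>
    { toFun := fun X => Matrix.fromBlocks 0 0 0 (((p : ℂ) * X.trace) • 1)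
      map_add' := fun X Y => by simp [Matrix.fromBlocks_add, mul_add, add_smul]
      map_smul' := fun c X => by simp [Matrix.fromBlocks_smul, smul_smul, mul_left_comm] }

/-- The probabilities of the two branches of the erasure channel. -/
def branchWeight (p : ℝ) (s : Bool) : ℝ := if s then p else 1 - p

/-- The output dimensions of the two branches of the erasure channel. -/
def branchDim (d : ℕ) (s : Bool) : ℕ := if s then 1 else d

theorem branchWeight_nonneg {p : ℝ} (hp : p ∈ Set.Icc (0 : ℝ) 1) (s : Bool) :
    0 ≤ branchWeight p s := by
  cases s <;> simp [branchWeight, hp.1, hp.2]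

theorem erasureChannel_eq_sum (d : ℕ) (p : ℝ) (X : Matrix (Fin d) (Fin d) ℂ) :
    erasureChannel d p X = ∑ s, erasureBranch d p s X := by
  simp [erasureChannel, erasureBranch, Matrix.fromBlocks_add]

theorem trace_erasureBranch (d : ℕ) (p : ℝ) (s : Bool) (X : Matrix (Fin d) (Fin d) ℂ) :
    (erasureBranch d p s X).trace = (branchWeight p s : ℂ) * X.trace := by
  cases s <;> simp [erasureBranch, branchWeight, Matrix.trace, Fintype.sum_sum_type, Finset.mul_sum]

theorem erasureBranch_apply_eq_zero (d : ℕ) (p : ℝ) {s : Bool} (X : Matrix (Fin d) (Fin d) ℂ)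
    {y y' : Fin d ⊕ Unit} (h : y.isRight ≠ s ∨ y'.isRight ≠ s) :
    erasureBranch d p s X y y' = 0 := by
  cases s <;> rcases y with i | i <;> rcases y' with j | j <;> simp_all [erasureBranch]

/-- Kraus operators of the branches of the erasure channel. -/
def branchKraus (d : ℕ) (p : ℝ) :
    Bool → Option (Fin d) → Matrix (Fin d ⊕ Unit) (Fin d) ℂ
  | false, none => Matrix.of fun y x => if y = Sum.inl x then (√(1 - p) : ℂ) else 0
  | true, some i => Matrix.of fun y x => if y = Sum.inr () ∧ x = i then (√p : ℂ) else 0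
  | _, _ => 0

theorem erasureBranch_eq_kraus {d : ℕ} {p : ℝ} (hp : p ∈ Set.Icc (0 : ℝ) 1) (s : Bool)
    (X : Matrix (Fin d) (Fin d) ℂ) :
    erasureBranch d p s X =
      ∑ i, branchKraus d p s i * X * (branchKraus d p s i).conjTranspose := by
  have h0 : ((√p : ℝ) : ℂ) * (√p : ℝ) = p := by
    rw [← Complex.ofReal_mul, Real.mul_self_sqrt hp.1]
  have h1 : ((√(1 - p) : ℝ) : ℂ) * (√(1 - p) : ℝ) = 1 - p := by
    rw [← Complex.ofReal_mul, Real.mul_self_sqrt (sub_nonneg.2 hp.2)]; simp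
  ext y y'
  cases s
  · rcases y with i | i <;> rcases y' with j | j <;>
      simp [erasureBranch, branchKraus, Matrix.mul_apply, Matrix.conjTranspose_apply, apply_ite, ← h1]
    ring
  · rcases y with i | i <;> rcases y' with j | j <;>
      simp [erasureBranch, branchKraus, Matrix.mul_apply, Matrix.conjTranspose_apply, ← h0,
        Matrix.sum_apply, Matrix.trace, Finset.mul_sum, apply_ite]
    exact Finset.sum_congr rfl fun x _ => by ring

/-- This is the dimension of the sector of outputs with erasure pattern `s`. -/
theorem card_filter_pattern (d : ℕ) {n : ℕ} (s : Fin n → Bool) :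
    (Finset.univ.filter fun y : Fin n → Fin d ⊕ Unit => ∀ k, (y k).isRight = s k).card =
      ∏ k, branchDim d (s k) := by
  have h : ∀ b : Bool, (Finset.univ.filter fun y : Fin d ⊕ Unit => y.isRight = b).card =
      branchDim d b := by
    intro b
    rw [Finset.card_filter, Fintype.sum_sum_type]
    cases b <;> simp [branchDim]
  simp only [← h]
  rw [← Fintype.card_piFinset]
  congr 1
  ext y
  simp [Fintype.mem_piFinset]

section Pattern

variable {d n : ℕ} {p : ℝ} (hp : p ∈ Set.Icc (0 : ℝ) 1)
  {ρ : Matrix (Fin n → Fin d) (Fin n → Fin d) ℂ}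
  (hρ : IsDensity ρ) (s : Fin n → Bool)

include hp hρ

theorem erasure_pattern_posSemidef :
    (tensorMap (fun k => erasureBranch d p (s k)) ρ).PosSemidef :=
  tensorMap_posSemidef (fun k X => erasureBranch_eq_kraus hp (s k) X) hρ.1

omit hp in
theorem trace_erasure_pattern :
    (tensorMap (fun k => erasureBranch d p (s k)) ρ).trace =
      ((∏ k, branchWeight p (s k) : ℝ) : ℂ) := by
  rw [trace_tensorMap (fun k X => trace_erasureBranch d p (s k) X), hρ.2]
  simp

omit hp hρ in
theorem erasure_pattern_apply_eq_zero {y y' : Fin n → Fin d ⊕ Unit}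
    (h : ¬ (∀ k, (y k).isRight = s k) ∨ ¬ ∀ k, (y' k).isRight = s k) :
    tensorMap (fun k => erasureBranch d p (s k)) ρ y y' = 0 := by
  obtain ⟨k, hk⟩ : ∃ k, (y k).isRight ≠ s k ∨ (y' k).isRight ≠ s k := by
    rcases h with h | h
    · obtain ⟨k, hk⟩ := not_forall.1 h
      exact ⟨k, Or.inl hk⟩
    · obtain ⟨k, hk⟩ := not_forall.1 h
      exact ⟨k, Or.inr hk⟩
  rw [tensorMap_apply]
  refine Finset.sum_eq_zero fun x _ => Finset.sum_eq_zero fun x' _ => ?_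
  rw [Finset.prod_eq_zero (Finset.mem_univ k) (erasureBranch_apply_eq_zero d p _ hk), mul_zero]

/-- The block lives in the sector of `s`, so `Λ` can be compressed by the sector projection `P`
before applying `Tr(AB) ≤ Tr(A) Tr(B)`. Keeping only the sector's diagonal entries is what later
produces its dimension. -/
theorem trace_mul_erasure_pattern_le
    {Λ : Matrix (Fin n → Fin d ⊕ Unit) (Fin n → Fin d ⊕ Unit) ℂ} (hΛ : Λ.PosSemidef) :
    (Λ * tensorMap (fun k => erasureBranch d p (s k)) ρ).trace.re ≤
      (∏ k, branchWeight p (s k)) *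
        ∑ y with ∀ k, (y k).isRight = s k, (Λ y y).re := by
  set T := tensorMap (fun k => erasureBranch d p (s k)) ρ with hT
  let P : Matrix (Fin n → Fin d ⊕ Unit) (Fin n → Fin d ⊕ Unit) ℂ :=
    Matrix.diagonal fun y => if ∀ k, (y k).isRight = s k then 1 else 0
  have hP : P.conjTranspose = P := by
    rw [Matrix.diagonal_conjTranspose]
    congr 1
    ext y
    simp [apply_ite]
  have hPT : T = P * T * P := by
    ext y y'
    rw [Matrix.mul_diagonal, Matrix.diagonal_mul]
    by_cases h1 : ∀ k, (y k).isRight = s k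
    · by_cases h2 : ∀ k, (y' k).isRight = s k
      · simp [h1, h2]
      · rw [hT, erasure_pattern_apply_eq_zero s (Or.inr h2)]; simp
    · rw [hT, erasure_pattern_apply_eq_zero s (Or.inl h1)]; simp
  have hΛP : (P * Λ * P).PosSemidef := by
    have := hΛ.mul_mul_conjTranspose_same P
    rwa [hP] at this
  have h := trace_mul_re_le hΛP (erasure_pattern_posSemidef hp hρ s) (trace_erasure_pattern hρ s)
  have h1 : (Λ * T).trace = (P * Λ * P * T).trace := by
    conv_lhs => rw [hPT]
    rw [← mul_assoc, Matrix.trace_mul_comm]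
    simp only [mul_assoc]
  have h2 : (P * Λ * P).trace.re = ∑ y with ∀ k, (y k).isRight = s k, (Λ y y).re := by
    rw [Finset.sum_filter, Matrix.trace, Complex.re_sum]
    refine Finset.sum_congr rfl fun y _ => ?_
    rw [Matrix.diag_apply, Matrix.mul_diagonal, Matrix.diagonal_mul]
    split_ifs <;> simp
  rw [h1, ← h2]
  exact h

end Pattern

/-! ### Success probability of a code, pattern by pattern. -/

theorem ClassicalCode.pos {a b : Type*} [Fintype a] [Fintype b] [DecidableEq b] [Nonempty b]
    {n M : ℕ} (C : ClassicalCode a b n M) : 0 < M := by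
  rcases Nat.eq_zero_or_pos M with rfl | h
  · have := C.meas_sum
    rw [Finset.univ_eq_empty, Finset.sum_empty] at this
    exact absurd this zero_ne_one
  · exact h

theorem ClassicalCode.one_sub_meas_posSemidef {a b : Type*} [Fintype a] [Fintype b] [DecidableEq b]
    {n M : ℕ} (C : ClassicalCode a b n M) (m : Fin M) : (1 - C.meas m).PosSemidef := by
  rw [← C.meas_sum, ← Finset.add_sum_erase _ _ (Finset.mem_univ m), add_sub_cancel_left]
  exact Matrix.posSemidef_sum _ fun i _ => C.meas_posSemidef i

theorem ClassicalCode.successProb_erasure {d n M : ℕ} {p : ℝ}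
    (C : ClassicalCode (Fin d) (Fin d ⊕ Unit) n M) :
    C.successProb (erasureChannel d p) = ∑ s : Fin n → Bool, (1 / (M : ℝ)) *
      ∑ m, (C.meas m * tensorMap (fun k => erasureBranch d p (s k)) (C.state m)).trace.re := by
  rw [← Finset.mul_sum, Finset.sum_comm, ClassicalCode.successProb]
  congr 1
  refine Finset.sum_congr rfl fun m _ => ?_
  rw [tensorPower_eq_sum_tensorMap (erasureChannel_eq_sum d p), Finset.mul_sum, Matrix.trace_sum,
    Complex.re_sum]

theorem ClassicalCode.successProb_erasure_nonneg {d n M : ℕ} {p : ℝ} (hp : p ∈ Set.Icc (0 : ℝ) 1)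
    (C : ClassicalCode (Fin d) (Fin d ⊕ Unit) n M) :
    0 ≤ C.successProb (erasureChannel d p) := by
  rw [C.successProb_erasure]
  refine Finset.sum_nonneg fun s _ => mul_nonneg (by positivity) (Finset.sum_nonneg fun m _ => ?_)
  exact trace_mul_re_nonneg (C.meas_posSemidef m)
    (erasure_pattern_posSemidef hp (C.state_isDensity m) s)

/-- Given the erasure pattern, decoding succeeds at best with probability
`min 1 (D / M)`, where `D` is the dimension of the space of the surviving systems. -/
theorem ClassicalCode.successProb_erasure_le {d n M : ℕ} {p : ℝ} (hp : p ∈ Set.Icc (0 : ℝ) 1)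
    (C : ClassicalCode (Fin d) (Fin d ⊕ Unit) n M) :
    C.successProb (erasureChannel d p) ≤ ∑ s : Fin n → Bool,
      (∏ k, branchWeight p (s k)) * min 1 ((∏ k, (branchDim d (s k) : ℝ)) / M) := by
  have hM : (0 : ℝ) < M := by exact_mod_cast C.pos
  rw [C.successProb_erasure]
  refine Finset.sum_le_sum fun s _ => ?_
  have hw : 0 ≤ ∏ k, branchWeight p (s k) :=
    Finset.prod_nonneg fun k _ => branchWeight_nonneg hp (s k)
  rw [mul_min_of_nonneg _ _ hw, mul_one, one_div_mul_eq_div, mul_div_assoc', le_min_iff,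
    div_le_div_iff_of_pos_right hM, div_le_iff₀ hM]
  constructor
  -- The bound by `1`: each measurement operator satisfies `Λ_m ≤ 1`.
  · calc _ ≤ ∑ m : Fin M, ∏ k, branchWeight p (s k) := Finset.sum_le_sum fun m _ => by
          have h := trace_mul_re_nonneg (C.one_sub_meas_posSemidef m)
            (erasure_pattern_posSemidef hp (C.state_isDensity m) s)
          rw [sub_mul, one_mul, Matrix.trace_sub, trace_erasure_pattern (C.state_isDensity m),
            Complex.sub_re, Complex.ofReal_re] at h
          linarith
      _ = _ := by simp [mul_comm]
  -- The bound by `D / M`: since the `Λ_m` sum to `1`, their diagonal entries over the sector add up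
  -- to its dimension.
  · calc _ ≤ ∑ m : Fin M, (∏ k, branchWeight p (s k)) *
          ∑ y with ∀ k, (y k).isRight = s k, (C.meas m y y).re := Finset.sum_le_sum fun m _ =>
            trace_mul_erasure_pattern_le hp (C.state_isDensity m) s (C.meas_posSemidef m)
      _ = _ := by
          rw [← Finset.mul_sum, Finset.sum_comm]
          congr 1
          have h : ∀ y, ∑ m, (C.meas m y y).re = 1 := by
            intro y
            rw [← Complex.re_sum, ← Matrix.sum_apply, C.meas_sum, Matrix.one_apply_eq,
              Complex.one_re]
          simp only [h, Finset.sum_const, nsmul_eq_mul, mul_one, card_filter_pattern]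
          push_cast
          rfl

/-! ### The Rényi bound and the exponential strong converse. -/

/-- Positions are erased independently, so the expectation of a product factorizes. -/
theorem sum_prod_branch {n : ℕ} (p : ℝ) (f : Bool → ℝ) :
    ∑ s : Fin n → Bool, (∏ k, branchWeight p (s k)) * ∏ k, f (s k) =
      ((1 - p) * f false + p * f true) ^ n := by
  simp only [← Finset.prod_mul_distrib]
  rw [← Fintype.prod_sum fun (_ : Fin n) b => branchWeight p b * f b]
  simp [branchWeight, add_comm]

theorem one_sub_mul_rpow_add_pos {d : ℕ} (hd : 0 < d) {p : ℝ} (hp : p ∈ Set.Icc (0 : ℝ) 1) (t : ℝ) :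
    0 < (1 - p) * (d : ℝ) ^ t + p := by
  have hdt : 0 < (d : ℝ) ^ t := Real.rpow_pos_of_pos (by exact_mod_cast hd) t
  rcases hp.1.eq_or_lt with h | h
  · rw [← h]; simpa using hdt
  · have := mul_nonneg (sub_nonneg.2 hp.2) hdt.le
    linarith

/-- This interpolation drives both the converse and the random coding bound. -/
theorem min_one_le_rpow {x θ : ℝ} (hx : 0 ≤ x) (hθ : 0 ≤ θ) (hθ1 : θ ≤ 1) :
    min 1 x ≤ x ^ θ := by
  rcases le_total 1 x with h | h
  · exact (min_le_left _ _).trans (Real.one_le_rpow h hθ)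
  · refine (min_le_right _ _).trans ?_
    rcases hx.eq_or_lt with rfl | hx
    · exact Real.rpow_nonneg le_rfl _
    · simpa using Real.rpow_le_rpow_of_exponent_ge hx h hθ1

/-- The logarithm vanishes at `α = 1`, so `renyiBound` is its slope there and the limit is a
derivative. The limit is two-sided: the converse uses the right, achievability the left. -/
theorem tendsto_renyiBound {d : ℕ} (hd : 0 < d) {p : ℝ} (hp : p ∈ Set.Icc (0 : ℝ) 1) :
    Tendsto (fun α : ℝ => renyiBound d p α) (𝓝[≠] 1) (𝓝 ((1 - p) * Real.logb 2 d)) := by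
  have hd' : (0 : ℝ) < d := by exact_mod_cast hd
  have h1 : HasDerivAt (fun α : ℝ => (1 - p) * (d : ℝ) ^ (α - 1) + p)
      ((1 - p) * Real.log d) 1 := by
    have h := (((hasDerivAt_id (1 : ℝ)).sub_const 1).const_rpow hd').const_mul (1 - p)
      |>.add_const p
    simpa using h
  have h2 : HasDerivAt (fun α : ℝ => Real.logb 2 ((1 - p) * (d : ℝ) ^ (α - 1) + p))
      ((1 - p) * Real.logb 2 d) 1 := by
    have h := (h1.log (one_sub_mul_rpow_add_pos hd hp _).ne').div_const (Real.log 2)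
    refine (h.congr_deriv ?_ : HasDerivAt _ _ _)
    simp [mul_div_assoc, Real.logb]
  have h3 := hasDerivAt_iff_tendsto_slope.1 h2
  refine h3.congr fun α => ?_
  simp [slope, renyiBound]

theorem ClassicalCode.successProb_erasure_le_rpow {d n M : ℕ} (hd : 0 < d) {p : ℝ}
    (hp : p ∈ Set.Icc (0 : ℝ) 1) (C : ClassicalCode (Fin d) (Fin d ⊕ Unit) n M) (hn : 0 < n)
    {α : ℝ} (hα : 1 < α) :
    C.successProb (erasureChannel d p) ≤
      (2 : ℝ) ^ (-(n : ℝ) * ((α - 1) / α) * (rate n M - renyiBound d p α)) := by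
  have hM : (0 : ℝ) < M := by exact_mod_cast C.pos
  have hα0 : 0 < α := by linarith
  have hα1 : 0 < α - 1 := by linarith
  set θ := (α - 1) / α with hθ
  have hθ0 : 0 < θ := div_pos hα1 hα0
  have hθ1 : θ ≤ 1 := (div_le_one hα0).2 (by linarith)
  set A := (1 - p) * (d : ℝ) ^ (α - 1) + p with hA
  have hApos : 0 < A := one_sub_mul_rpow_add_pos hd hp _
  have hw : ∀ s : Fin n → Bool, 0 ≤ ∏ k, branchWeight p (s k) := fun s =>
    Finset.prod_nonneg fun k _ => branchWeight_nonneg hp (s k)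
  have hD : ∀ s : Fin n → Bool, (0 : ℝ) ≤ ∏ k, (branchDim d (s k) : ℝ) := fun s =>
    Finset.prod_nonneg fun k _ => by positivity
  have hsum : ∑ s : Fin n → Bool, (∏ k, branchWeight p (s k)) = 1 := by
    have := sum_prod_branch (n := n) p (fun _ => 1)
    simpa using this
  -- Convexity of `x ^ α` gives `E[D ^ θ] ≤ E[D ^ (θ α)] ^ (1 / α)`, and `θ α = α - 1`.
  have hjensen : ∑ s : Fin n → Bool, (∏ k, branchWeight p (s k)) *
      (∏ k, (branchDim d (s k) : ℝ)) ^ θ ≤ A ^ ((n : ℝ) / α) := by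
    have h := Real.rpow_arith_mean_le_arith_mean_rpow Finset.univ
      (fun s : Fin n → Bool => ∏ k, branchWeight p (s k))
      (fun s => (∏ k, (branchDim d (s k) : ℝ)) ^ θ) (fun s _ => hw s) hsum
      (fun s _ => Real.rpow_nonneg (hD s) _) hα.le
    have h2 : ∀ s : Fin n → Bool, ((∏ k, (branchDim d (s k) : ℝ)) ^ θ) ^ α =
        ∏ k, (branchDim d (s k) : ℝ) ^ (α - 1) := by
      intro s
      rw [← Real.rpow_mul (hD s), hθ, div_mul_cancel₀ _ hα0.ne',
        Real.finsetProd_rpow _ _ fun k _ => by positivity]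
    simp only [h2] at h
    rw [sum_prod_branch p fun b => (branchDim d b : ℝ) ^ (α - 1)] at h
    have h3 : (1 - p) * (branchDim d false : ℝ) ^ (α - 1) +
        p * (branchDim d true : ℝ) ^ (α - 1) = A := by
      simp [branchDim, hA]
    rw [h3] at h
    have h0 : 0 ≤ ∑ s : Fin n → Bool, (∏ k, branchWeight p (s k)) *
      (∏ k, (branchDim d (s k) : ℝ)) ^ θ :=
      Finset.sum_nonneg fun s _ => mul_nonneg (hw s) (Real.rpow_nonneg (hD s) _)
    have h4 := Real.rpow_le_rpow (Real.rpow_nonneg h0 _) h (inv_nonneg.2 hα0.le)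
    rwa [← Real.rpow_mul h0, mul_inv_cancel₀ hα0.ne', Real.rpow_one, ← Real.rpow_natCast,
      ← Real.rpow_mul hApos.le, ← div_eq_mul_inv] at h4
  have hrhs : (2 : ℝ) ^ (-(n : ℝ) * θ * (rate n M - renyiBound d p α)) =
      A ^ ((n : ℝ) / α) / (M : ℝ) ^ θ := by
    have hn' : (n : ℝ) ≠ 0 := by exact_mod_cast hn.ne'
    have : -(n : ℝ) * θ * (rate n M - renyiBound d p α) =
        Real.logb 2 A * (n / α) - Real.logb 2 M * θ := by
      rw [rate, renyiBound, ← hA, hθ]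
      field_simp
      ring
    rw [this, Real.rpow_sub two_pos, Real.rpow_mul two_pos.le, Real.rpow_mul two_pos.le,
      Real.rpow_logb two_pos (by norm_num) hApos, Real.rpow_logb two_pos (by norm_num) hM]
  calc _ ≤ _ := C.successProb_erasure_le hp
    _ ≤ ∑ s : Fin n → Bool, (∏ k, branchWeight p (s k)) *
        ((∏ k, (branchDim d (s k) : ℝ)) ^ θ / (M : ℝ) ^ θ) :=
      Finset.sum_le_sum fun s _ => mul_le_mul_of_nonneg_left (by
        rw [← Real.div_rpow (hD s) hM.le]
        exact min_one_le_rpow (div_nonneg (hD s) hM.le) hθ0.le hθ1) (hw s)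
    _ ≤ _ := by
      simp only [mul_div_assoc']
      rw [← Finset.sum_div, hrhs]
      exact div_le_div_of_nonneg_right hjensen (Real.rpow_nonneg hM.le _)

theorem exists_exponent_pos {d : ℕ} (hd : 0 < d) {p : ℝ} (hp : p ∈ Set.Icc (0 : ℝ) 1) {R : ℝ}
    (hR : (1 - p) * Real.logb 2 d < R) :
    ∃ α ∈ Set.Ioc (1 : ℝ) 2, 0 < ((α - 1) / α) * (R - renyiBound d p α) := by
  have h1 : ∀ᶠ α in 𝓝[>] (1 : ℝ), renyiBound d p α < R :=
    ((tendsto_renyiBound hd hp).mono_left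
      (nhdsWithin_mono _ fun x (hx : 1 < x) => hx.ne')).eventually_lt_const hR
  have h2 : ∀ᶠ α in 𝓝[>] (1 : ℝ), α ∈ Set.Ioc (1 : ℝ) 2 :=
    Ioc_mem_nhdsGT one_lt_two
  obtain ⟨α, hα1, hα2⟩ := (h1.and h2).exists
  exact ⟨α, hα2, mul_pos (div_pos (by linarith [hα2.1]) (by linarith [hα2.1])) (by linarith)⟩

theorem tendsto_two_rpow_neg_mul {δ : ℝ} (hδ : 0 < δ) :
    Tendsto (fun n : ℕ => (2 : ℝ) ^ (-((n : ℝ) * δ))) atTop (𝓝 0) :=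
  (tendsto_rpow_atBot_of_base_gt_one 2 one_lt_two).comp
    (tendsto_neg_atTop_atBot.comp (tendsto_natCast_atTop_atTop.atTop_mul_const hδ))

/-- Above the capacity the success probability decays exponentially. -/
theorem exists_exponential_bound {d : ℕ} (hd : 0 < d) {p : ℝ} (hp : p ∈ Set.Icc (0 : ℝ) 1) {R : ℝ}
    (hR : (1 - p) * Real.logb 2 d < R) :
    ∃ δ > 0, ∀ (n M : ℕ) (C : ClassicalCode (Fin d) (Fin d ⊕ Unit) n M), 0 < n → R ≤ rate n M →
      C.successProb (erasureChannel d p) ≤ (2 : ℝ) ^ (-((n : ℝ) * δ)) := by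
  obtain ⟨α, hα, hpos⟩ := exists_exponent_pos hd hp hR
  refine ⟨_, hpos, fun n M C hn hrate => (C.successProb_erasure_le_rpow hd hp hn hα.1).trans ?_⟩
  refine Real.rpow_le_rpow_of_exponent_le one_le_two ?_
  rw [neg_mul, neg_mul, neg_le_neg_iff, mul_assoc]
  have hα1 := hα.1
  gcongr

/-! ### Random coding for a finite classical channel. -/

section RandomCoding

variable {X Y : Type*} [Fintype X] [Fintype Y]

/-- Two distinct codewords of a uniformly random codebook are independent. -/
theorem card_mul_sum_pair {ι : Type*} [Fintype ι] [DecidableEq ι] {i j : ι} (hij : i ≠ j)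
    (f g : X → ℝ) :
    (Fintype.card X : ℝ) * ∑ c : ι → X, f (c i) * g (c j) = (∑ c : ι → X, f (c i)) * ∑ x, g x := by
  -- Swapping the `j`-th codeword with a fresh sample is a bijection that leaves the `i`-th one
  -- alone.
  let σ : (ι → X) × X → (ι → X) × X := fun q => (Function.update q.1 j q.2, q.1 j)
  have hσ : Function.Involutive σ := fun q => by simp [σ]
  calc _ = ∑ q : (ι → X) × X, f (q.1 i) * g (q.1 j) := by
        simp [Fintype.sum_prod_type, Finset.mul_sum]
    _ = ∑ q : (ι → X) × X, f (q.1 i) * g q.2 :=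
        Fintype.sum_equiv hσ.toPerm _ _ fun q => by simp [σ, Function.update_of_ne hij]
    _ = _ := by rw [Fintype.sum_prod_type, Finset.sum_mul_sum]

open Classical in
/-- Random coding: if, for each input, the average over the outputs of the probability that some of
`L` other random codewords is compatible with the output is at most `B`, then some code with
`L + 1` codewords has average error probability at most `B`. -/
theorem exists_code_error_le (W : X → Y → ℝ) (hW : ∀ x y, 0 ≤ W x y) (r : X → Y → Prop)
    (hr : ∀ x y, W x y ≠ 0 → r x y) [Nonempty X] (L : ℕ) {B : ℝ}
    (hB : ∀ x, ∑ y, W x y *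
      min 1 (L * ((Finset.univ.filter fun x' => r x' y).card / Fintype.card X : ℝ)) ≤ B) :
    ∃ (c : Fin (L + 1) → X) (D : Y → Fin (L + 1)),
      ∑ m, ∑ y, (if D y = m then 0 else W (c m) y) ≤ (L + 1) * B := by
  have hX : (0 : ℝ) < Fintype.card X := by exact_mod_cast Fintype.card_pos
  -- The decoder picks any compatible codeword; the default `0` matters only for outputs that no
  -- codeword can produce.
  let D : (Fin (L + 1) → X) → Y → Fin (L + 1) := fun c y =>
    if h : ∃ m, r (c m) y then h.choose else 0
  -- `Z` counts the other compatible codewords. A wrong decision on an output of positive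
  -- probability forces `Z ≥ 1`.
  let Z : (Fin (L + 1) → X) → Fin (L + 1) → Y → ℝ := fun c m y =>
    ∑ m' ∈ Finset.univ.erase m, if r (c m') y then 1 else 0
  have hZ : ∀ c m y, 0 ≤ Z c m y := fun c m y => Finset.sum_nonneg fun _ _ => by positivity
  have herr : ∀ c m y, (if D c y = m then 0 else W (c m) y) ≤ W (c m) y * min 1 (Z c m y) := by
    intro c m y
    have hmin : 0 ≤ min 1 (Z c m y) := le_min zero_le_one (hZ c m y)
    split_ifs with h
    · exact mul_nonneg (hW _ _) hmin
    · by_cases h0 : W (c m) y = 0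
      · simp [h0]
      · have hex : ∃ m, r (c m) y := ⟨m, hr _ _ h0⟩
        have hD : r (c (D c y)) y := by
          simp only [D, dif_pos hex]
          exact hex.choose_spec
        have h1 : 1 ≤ Z c m y := by
          have := Finset.single_le_sum (f := fun m' => if r (c m') y then (1 : ℝ) else 0)
            (s := Finset.univ.erase m) (fun _ _ => by positivity)
            (Finset.mem_erase.2 ⟨h, Finset.mem_univ _⟩)
          rwa [if_pos hD] at this
        rw [min_eq_left h1, mul_one]
  have havg : ∀ m y, ∑ c : Fin (L + 1) → X, W (c m) y * min 1 (Z c m y) ≤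
      ∑ c : Fin (L + 1) → X, W (c m) y *
        min 1 (L * ((Finset.univ.filter fun x' => r x' y).card / Fintype.card X : ℝ)) := by
    intro m y
    -- The mean of `min 1 Z` is bounded by `1` and by the mean of `Z`. The latter splits by pairwise
    -- independence into `L` equal terms.
    rw [← Finset.sum_mul, mul_min_of_nonneg _ _ (Finset.sum_nonneg fun _ _ => hW _ _), le_min_iff]
    constructor
    · rw [mul_one]
      exact Finset.sum_le_sum fun c _ =>
        mul_le_of_le_one_right (hW _ _) (min_le_left _ _)
    · calc _ ≤ ∑ c : Fin (L + 1) → X, W (c m) y * Z c m y := Finset.sum_le_sum fun c _ =>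
            mul_le_mul_of_nonneg_left (min_le_right _ _) (hW _ _)
        _ = ∑ m' ∈ Finset.univ.erase m, ∑ c : Fin (L + 1) → X,
              W (c m) y * (if r (c m') y then 1 else 0) := by
            simp only [Z, Finset.mul_sum]
            exact Finset.sum_comm
        _ = ∑ m' ∈ Finset.univ.erase m, (∑ c : Fin (L + 1) → X, W (c m) y) *
              ((Finset.univ.filter fun x' => r x' y).card / Fintype.card X : ℝ) := by
            refine Finset.sum_congr rfl fun m' hm' => ?_
            have h := card_mul_sum_pair (Finset.ne_of_mem_erase hm').symm (fun x => W x y)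
              (fun x => if r x y then (1 : ℝ) else 0)
            rw [Finset.sum_boole] at h
            rw [mul_div_assoc', eq_div_iff hX.ne', ← h, mul_comm]
        _ = _ := by
            rw [Finset.sum_const, Finset.card_erase_of_mem (Finset.mem_univ m)]
            simp
            ring
  have htotal : ∑ c : Fin (L + 1) → X, ∑ m, ∑ y, (if D c y = m then 0 else W (c m) y) ≤
      ∑ _c : Fin (L + 1) → X, ((L : ℝ) + 1) * B := by
    calc _ ≤ ∑ c : Fin (L + 1) → X, ∑ m, ∑ y, W (c m) y * min 1 (Z c m y) :=
          Finset.sum_le_sum fun c _ => Finset.sum_le_sum fun m _ => Finset.sum_le_sum fun y _ =>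
            herr c m y
      _ = ∑ m, ∑ y, ∑ c : Fin (L + 1) → X, W (c m) y * min 1 (Z c m y) := by
          rw [Finset.sum_comm]
          exact Finset.sum_congr rfl fun m _ => Finset.sum_comm
      _ ≤ ∑ m, ∑ y, ∑ c : Fin (L + 1) → X, W (c m) y *
        min 1 (L * ((Finset.univ.filter fun x' => r x' y).card / Fintype.card X : ℝ)) :=
          Finset.sum_le_sum fun m _ => Finset.sum_le_sum fun y _ => havg m y
      _ = ∑ c : Fin (L + 1) → X, ∑ m, ∑ y, W (c m) y *
        min 1 (L * ((Finset.univ.filter fun x' => r x' y).card / Fintype.card X : ℝ)) :=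
          (Finset.sum_congr rfl fun m _ => Finset.sum_comm).trans Finset.sum_comm
      _ ≤ ∑ c : Fin (L + 1) → X, ∑ _m : Fin (L + 1), B :=
          Finset.sum_le_sum fun c _ => Finset.sum_le_sum fun m _ => hB (c m)
      _ = _ := by simp
  -- Some codebook does at least as well as the average.
  obtain ⟨c, -, hc⟩ := Finset.exists_le_of_sum_le Finset.univ_nonempty htotal
  exact ⟨c, D c, hc⟩

end RandomCoding

/-! ### Achievability through basis-state codes. -/

/-- The transition probabilities of the classical erasure channel. -/
def erasureProb (d : ℕ) (p : ℝ) (i : Fin d) (y : Fin d ⊕ Unit) : ℝ :=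
  Sum.elim (fun j => if i = j then 1 - p else 0) (fun _ => p) y

theorem erasureProb_nonneg {d : ℕ} {p : ℝ} (hp : p ∈ Set.Icc (0 : ℝ) 1) (i : Fin d)
    (y : Fin d ⊕ Unit) : 0 ≤ erasureProb d p i y := by
  rcases y with j | j
  · have := hp.2
    simp only [erasureProb, Sum.elim_inl]
    split_ifs <;> linarith
  · exact hp.1

theorem erasureChannel_single (d : ℕ) (p : ℝ) (i : Fin d) :
    erasureChannel d p (Matrix.single i i 1) =
      Matrix.diagonal fun y => (erasureProb d p i y : ℂ) := by
  ext y y'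
  rcases y with j | j <;> rcases y' with j' | j' <;>
    simp [erasureChannel, erasureProb, Matrix.single_apply, Matrix.diagonal_apply]
  rcases eq_or_ne i j with rfl | h1
  · rcases eq_or_ne i j' with rfl | h2 <;> simp_all
  · simp [h1]

theorem tensorPower_erasureChannel_single (d : ℕ) (p : ℝ) {n : ℕ} (x : Fin n → Fin d) :
    tensorPower (erasureChannel d p) n (Matrix.single x x 1) =
      Matrix.diagonal fun y => ((∏ k, erasureProb d p (x k) (y k) : ℝ) : ℂ) := by
  have h : (Matrix.single x x 1 : Matrix (Fin n → Fin d) (Fin n → Fin d) ℂ) =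
      tensorProd fun k => Matrix.single (x k) (x k) 1 := by
    ext y y'
    simp only [tensorProd, Matrix.of_apply, Matrix.single_apply, Finset.prod_ite_zero,
      Finset.prod_const_one]
    congr 1
    simp [funext_iff, forall_and]
  rw [h, tensorPower_tensorProd]
  simp only [erasureChannel_single]
  ext y y'
  simp only [tensorProd, Matrix.of_apply, Matrix.diagonal_apply, Finset.prod_ite_zero]
  simp [funext_iff]

/-- The code with codewords `c`, encoded in the product basis, and with the decoder `D`, which
measures all outputs in the product basis. -/
def basisCode {d n M : ℕ} (c : Fin M → Fin n → Fin d) (D : (Fin n → Fin d ⊕ Unit) → Fin M) :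
    ClassicalCode (Fin d) (Fin d ⊕ Unit) n M where
  state m := Matrix.single (c m) (c m) 1
  state_isDensity m := by
    refine ⟨?_, by simp⟩
    rw [← Matrix.diagonal_single]
    refine Matrix.PosSemidef.diagonal ?_
    exact Pi.single_nonneg.2 zero_le_one
  meas m := Matrix.diagonal fun y => if D y = m then 1 else 0
  meas_posSemidef m := by
    refine Matrix.PosSemidef.diagonal fun y => ?_
    simp only [Pi.zero_apply]
    split_ifs <;> simp
  meas_sum := by
    ext y y'
    rw [Matrix.sum_apply]
    by_cases h : y = y' <;> simp [Matrix.one_apply, h]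

theorem sum_erasureProb (d : ℕ) (p : ℝ) (i : Fin d) : ∑ y, erasureProb d p i y = 1 := by
  simp [erasureProb, Fintype.sum_sum_type]

theorem successProb_basisCode {d n M : ℕ} (hM : 0 < M) (p : ℝ) (c : Fin M → Fin n → Fin d)
    (D : (Fin n → Fin d ⊕ Unit) → Fin M) :
    (basisCode c D).successProb (erasureChannel d p) =
      1 - (1 / (M : ℝ)) * ∑ m, ∑ y,
        (if D y = m then 0 else ∏ k, erasureProb d p (c m k) (y k)) := by
  have hM' : (M : ℝ) ≠ 0 := by exact_mod_cast hM.ne'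
  have h1 : ∀ m, ((basisCode c D).meas m *
      tensorPower (erasureChannel d p) n ((basisCode c D).state m)).trace.re =
      1 - ∑ y, (if D y = m then 0 else ∏ k, erasureProb d p (c m k) (y k)) := by
    intro m
    have h2 : ∑ y : Fin n → Fin d ⊕ Unit, ∏ k, erasureProb d p (c m k) (y k) = 1 := by
      rw [← Fintype.prod_sum fun k y => erasureProb d p (c m k) y]
      simp only [sum_erasureProb, Finset.prod_const_one]
    simp only [basisCode]
    rw [tensorPower_erasureChannel_single, Matrix.diagonal_mul_diagonal, Matrix.trace_diagonal,
      Complex.re_sum, eq_sub_iff_add_eq, ← Finset.sum_add_distrib, ← h2]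
    refine Finset.sum_congr rfl fun y _ => ?_
    split_ifs
    · rw [one_mul, Complex.ofReal_re, add_zero]
    · simp
  rw [ClassicalCode.successProb]
  simp only [h1, Finset.sum_sub_distrib]
  rw [mul_sub]
  simp [hM']

/-- The input symbol `i` is compatible with the output symbol `y`. -/
def Compatible {d : ℕ} (i : Fin d) (y : Fin d ⊕ Unit) : Prop :=
  Sum.elim (fun j => i = j) (fun _ => True) y

-- A uniformly random symbol matches a surviving output with probability `1 / d` and an erased one
-- always.
open Classical in
theorem card_compatible_div {d : ℕ} (hd : 0 < d) (y : Fin d ⊕ Unit) :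
    ((Finset.univ.filter fun i : Fin d => Compatible i y).card / d : ℝ) =
      Sum.elim (fun _ => (d : ℝ)⁻¹) (fun _ => 1) y := by
  have hd' : (d : ℝ) ≠ 0 := by exact_mod_cast hd.ne'
  rcases y with j | j
  · have h : (Finset.univ.filter fun i : Fin d => Compatible i (Sum.inl j)) = {j} := by
      ext i
      rw [Finset.mem_filter]
      simp [Compatible]
    simp [h]
  · have h : (Finset.univ.filter fun i : Fin d => Compatible i (Sum.inr j)) = Finset.univ := by
      ext i
      rw [Finset.mem_filter]
      simp [Compatible]
    simp [h, hd']

/-- Random coding bound for the erasure channel. -/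
theorem exists_code_successProb_ge {d : ℕ} (hd : 0 < d) {p : ℝ} (hp : p ∈ Set.Icc (0 : ℝ) 1)
    (n L : ℕ) {θ : ℝ} (hθ0 : 0 ≤ θ) (hθ1 : θ ≤ 1) :
    ∃ C : ClassicalCode (Fin d) (Fin d ⊕ Unit) n (L + 1),
      1 - (L : ℝ) ^ θ * ((1 - p) * (d : ℝ) ^ (-θ) + p) ^ n ≤
        C.successProb (erasureChannel d p) := by
  classical
  have : Nonempty (Fin d) := ⟨⟨0, hd⟩⟩
  let q : Fin d ⊕ Unit → ℝ := Sum.elim (fun _ => (d : ℝ)⁻¹) (fun _ => 1)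
  have hq : ∀ y, 0 ≤ q y := by
    rintro (j | j) <;> simp [q]
  have hcard : ∀ y : Fin n → Fin d ⊕ Unit,
      ((Finset.univ.filter fun x : Fin n → Fin d => ∀ k, Compatible (x k) (y k)).card /
        Fintype.card (Fin n → Fin d) : ℝ) = ∏ k, q (y k) := by
    intro y
    have h : (Finset.univ.filter fun x : Fin n → Fin d => ∀ k, Compatible (x k) (y k)) =
        Fintype.piFinset fun k => Finset.univ.filter fun i => Compatible i (y k) := by
      ext x; simp [Fintype.mem_piFinset]
    rw [h, Fintype.card_piFinset]
    simp only [q, ← card_compatible_div hd, Finset.prod_div_distrib]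
    simp
  obtain ⟨c, D, h⟩ := exists_code_error_le
    (fun (x : Fin n → Fin d) (y : Fin n → Fin d ⊕ Unit) => ∏ k, erasureProb d p (x k) (y k))
    (fun x y => Finset.prod_nonneg fun k _ => erasureProb_nonneg hp _ _)
    (fun x y => ∀ k, Compatible (x k) (y k))
    (fun x y hxy k => by
      have := Finset.prod_ne_zero_iff.1 hxy k (Finset.mem_univ k)
      revert this
      rcases y k with j | j
      · exact fun h => of_not_not fun hne => h (if_neg hne)
      · exact fun _ => trivial)
    L (B := (L : ℝ) ^ θ * ((1 - p) * (d : ℝ) ^ (-θ) + p) ^ n) (fun x => by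
      calc _ = ∑ y : Fin n → Fin d ⊕ Unit, (∏ k, erasureProb d p (x k) (y k)) *
            min 1 (L * ∏ k, q (y k)) := Finset.sum_congr rfl fun y _ => by
              rw [← hcard y]
              congr!
        _ ≤ ∑ y : Fin n → Fin d ⊕ Unit, (∏ k, erasureProb d p (x k) (y k)) *
            ((L : ℝ) ^ θ * ∏ k, q (y k) ^ θ) := Finset.sum_le_sum fun y _ => by
              refine mul_le_mul_of_nonneg_left ?_
                (Finset.prod_nonneg fun k _ => erasureProb_nonneg hp _ _)
              have hq' : 0 ≤ ∏ k, q (y k) := Finset.prod_nonneg fun k _ => hq _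
              rw [Real.finsetProd_rpow _ _ fun k _ => hq _, ← Real.mul_rpow (by positivity) hq']
              exact min_one_le_rpow (by positivity) hθ0 hθ1
        _ = (L : ℝ) ^ θ * ∑ y : Fin n → Fin d ⊕ Unit,
              ∏ k, erasureProb d p (x k) (y k) * q (y k) ^ θ := by
            rw [Finset.mul_sum]
            refine Finset.sum_congr rfl fun y _ => ?_
            rw [Finset.prod_mul_distrib]
            ring
        _ ≤ _ := by
            -- The sum over outputs factorizes over positions, and each factor is the same for every
            -- input symbol.
            rw [← Fintype.prod_sum fun k y => erasureProb d p (x k) y * q y ^ θ]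
            have h1 : ∀ i, ∑ y, erasureProb d p i y * q y ^ θ =
                (1 - p) * (d : ℝ) ^ (-θ) + p := by
              intro i
              simp [erasureProb, q, Fintype.sum_sum_type, Real.rpow_neg, Real.inv_rpow]
            simp [h1])
  refine ⟨basisCode c D, ?_⟩
  rw [successProb_basisCode L.succ_pos, sub_le_sub_iff_left]
  have hL : (0 : ℝ) < L + 1 := by positivity
  push_cast
  rw [one_div_mul_eq_div, div_le_iff₀ hL, mul_comm _ ((L : ℝ) + 1)]
  exact h

theorem isAchievable_of_lt {d : ℕ} (hd : 0 < d) {p : ℝ} (hp : p ∈ Set.Icc (0 : ℝ) 1) {R : ℝ}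
    (hR : R < (1 - p) * Real.logb 2 d) : IsAchievable (erasureChannel d p) R := by
  have h1 : ∀ᶠ α in 𝓝[<] (1 : ℝ), R < renyiBound d p α :=
    ((tendsto_renyiBound hd hp).mono_left
      (nhdsWithin_mono _ fun x (hx : x < 1) => hx.ne)).eventually_const_lt hR
  -- `α ≥ 0` keeps the interpolation exponent `θ = 1 - α` at most `1`.
  have h2 : ∀ᶠ α in 𝓝[<] (1 : ℝ), α ∈ Set.Ico (0 : ℝ) 1 := Ico_mem_nhdsLT one_pos
  obtain ⟨α, hα, hα0, hα1⟩ := (h1.and h2).exists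
  set A := (1 - p) * (d : ℝ) ^ (α - 1) + p with hA
  have hApos : 0 < A := one_sub_mul_rpow_add_pos hd hp _
  have hδ : 0 < (1 - α) * (renyiBound d p α - R) := mul_pos (by linarith) (by linarith)
  intro ε hε
  filter_upwards [(tendsto_two_rpow_neg_mul hδ).eventually_lt_const hε, eventually_gt_atTop 0]
    with n hn hn0
  have hn0' : (0 : ℝ) < n := by exact_mod_cast hn0
  -- With `M = L + 1`, the floor gives both `L ≤ 2 ^ (n R)` for the error bound and `M ≥ 2 ^ (n R)`
  -- for the rate.
  set L := ⌊(2 : ℝ) ^ (n * R)⌋₊ with hL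
  have hpow : (0 : ℝ) < 2 ^ (n * R) := Real.rpow_pos_of_pos two_pos _
  obtain ⟨C, hC⟩ := exists_code_successProb_ge hd hp n L (θ := 1 - α) (by linarith) (by linarith)
  refine ⟨L + 1, C, ?_, le_trans ?_ hC⟩
  · rw [rate, le_div_iff₀ hn0', mul_comm, Real.le_logb_iff_rpow_le one_lt_two (by positivity)]
    push_cast
    exact (Nat.lt_floor_add_one _).le
  · rw [sub_le_sub_iff_left, neg_sub, ← hA]
    refine le_trans ?_ hn.le
    have hLle : (L : ℝ) ^ (1 - α) ≤ (2 ^ (n * R)) ^ (1 - α) :=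
      Real.rpow_le_rpow (by positivity) (Nat.floor_le hpow.le) (by linarith)
    refine (mul_le_mul_of_nonneg_right hLle (by positivity)).trans_eq ?_
    have hAn : A ^ n = 2 ^ (Real.logb 2 A * n) := by
      rw [Real.rpow_mul two_pos.le, Real.rpow_logb two_pos (by norm_num) hApos, Real.rpow_natCast]
    rw [hAn, ← Real.rpow_mul two_pos.le, ← Real.rpow_add two_pos]
    congr 1
    rw [renyiBound, ← hA]
    have : α - 1 ≠ 0 := by linarith
    field_simp
    ring

/-- Above this value, exponential decay already rules out success probability `1/2`. Achievability
at the value itself is not needed: all smaller rates are achievable, which fixes the supremum. -/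
theorem isClassicalCapacity_erasureChannel {d : ℕ} (hd : 0 < d) {p : ℝ}
    (hp : p ∈ Set.Icc (0 : ℝ) 1) :
    IsClassicalCapacity (erasureChannel d p) ((1 - p) * Real.logb 2 d) := by
  constructor
  · intro R hR
    by_contra! hlt
    obtain ⟨δ, hδ, hbound⟩ := exists_exponential_bound hd hp hlt
    have h2 := (tendsto_two_rpow_neg_mul hδ).eventually_lt_const (half_pos one_pos)
    obtain ⟨n, ⟨⟨M, C, hrate, hsucc⟩, hn⟩, hn0⟩ :=
      (((hR (1 / 2) (half_pos one_pos)).and h2).and (eventually_gt_atTop 0)).exists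
    have := hbound n M C hn0 hrate
    linarith
  · intro b hb
    exact le_of_forall_lt fun R hR => by
      obtain ⟨R', h1, h2⟩ := exists_between hR
      exact h1.trans_le (hb (isAchievable_of_lt hd hp h2))

end QuantumErasure

end

theorem mainTheorem2 (d : ℕ) (hd : 0 < d) (p : ℝ) (hp : p ∈ Set.Icc (0 : ℝ) 1) :
    -- upper bound on the success probability of every code
    (∀ α ∈ Set.Ioc (1 : ℝ) 2, ∀ (n M : ℕ), 0 < n →
      ∀ C : QuantumErasure.ClassicalCode (Fin d) (Fin d ⊕ Unit) n M,
        C.successProb (QuantumErasure.erasureChannel d p) ≤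
          (2 : ℝ) ^ (-(n : ℝ) * ((α - 1) / α) *
            (QuantumErasure.rate n M - QuantumErasure.renyiBound d p α))) ∧
    -- the limit of the single-letter quantity
    Tendsto (fun α : ℝ => QuantumErasure.renyiBound d p α) (𝓝[≠] 1)
      (𝓝 ((1 - p) * Real.logb 2 d)) ∧
    -- the limit is the classical capacity
    QuantumErasure.IsClassicalCapacity (QuantumErasure.erasureChannel d p)
      ((1 - p) * Real.logb 2 d) ∧
    -- strong converse
    (∀ R : ℝ, (1 - p) * Real.logb 2 d < R →
      (∃ α ∈ Set.Ioc (1 : ℝ) 2,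
        0 < ((α - 1) / α) * (R - QuantumErasure.renyiBound d p α)) ∧
      (∀ (M : ℕ → ℕ)
        (C : ∀ n : ℕ, QuantumErasure.ClassicalCode (Fin d) (Fin d ⊕ Unit) n (M n)),
        (∀ᶠ n : ℕ in atTop, R ≤ QuantumErasure.rate n (M n)) →
        Tendsto (fun n : ℕ => (C n).successProb (QuantumErasure.erasureChannel d p))
          atTop (𝓝 0))) := by
  refine ⟨fun α hα n M hn C => C.successProb_erasure_le_rpow hd hp hn hα.1,
    QuantumErasure.tendsto_renyiBound hd hp, QuantumErasure.isClassicalCapacity_erasureChannel hd hp,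
    fun R hR => ⟨QuantumErasure.exists_exponent_pos hd hp hR, fun M C hrate => ?_⟩⟩
  obtain ⟨δ, hδ, hbound⟩ := QuantumErasure.exists_exponential_bound hd hp hR
  refine tendsto_of_tendsto_of_tendsto_of_le_of_le' tendsto_const_nhds
    (QuantumErasure.tendsto_two_rpow_neg_mul hδ)
    (Eventually.of_forall fun n => (C n).successProb_erasure_nonneg hp) ?_
  filter_upwards [hrate, eventually_gt_atTop 0] with n hn hn0
  exact hbound n (M n) (C n) hn0 hn
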